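/- All graphs are simple, finite and undirected. A walk in $G$ is a sequence $v_1,\dots,v_n$ of vertices with $v_iv_{i+1}\in E(G)$ for $1\le i<n$; it is a path if its vertices are pairwise distinct. A walk $v_1,\dots,v_{2t}$ with $t\ge1$ is repetitively coloured by a vertex colouring $f$ if $f(v_i)=f(v_{t+i})$ for all $i\in\{1,\dots,t\}$, and is boring if $v_i=v_{t+i}$ for all $i\in\{1,\dots,t\}$. Let $\pi(G)$ be the minimum $m$ such that $G$ has a vertex colouring with $m$ colours for which no path is repetitively coloured, and let $\sigma(G)$ be the minimum $m$ such that $G$ has a vertex colouring with $m$ colours for which every repetitively coloured walk is boring. The treewidth of $G$ is the minimum integer $k$ such that $G$ is a subgraph of a chordal graph with no clique on $k+2$ vertices (a graph is chordal if every cycle on at least four vertices has a chord). **Theorem.** Every graph $G$ with treewidth $k$ and maximum degree $\Delta\ge1$ satisfies $$\pi(G)\le 10(k+1)\left(\tfrac72\Delta-1\right)\quad\text{and}\quad\sigma(G)\le 10(k+1)\left(\tfrac72\Delta-1\right)(\Delta^2+1).$$ Moreover, there is an absolute constant $c$ such that every graph $G$ with treewidth $k$ and maximum degree $\Delta\ge1$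 satisfies $$\pi(G)\le c\,k\,\Delta\quad\text{and}\quad\sigma(G)\le c\,k\,\Delta^3.$$ -/

import Mathlib

namespace NonRep

universe u v

variable {V : Type u} {C : Type v}

/-- A finite sequence `w 0, w 1, …, w (n - 1)` of vertices is a walk in `G` if consecutive vertices
are adjacent. Only the first `n` values of `w` matter. -/
def IsWalkSeq (G : SimpleGraph V) (n : ℕ) (w : ℕ → V) : Prop :=
  ∀ i, i + 1 < n → G.Adj (w i) (w (i + 1))

/-- A path is a walk whose vertices are pairwise distinct. -/
def IsPathSeq (G : SimpleGraph V) (n : ℕ) (w : ℕ → V) : Prop :=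
  IsWalkSeq G n w ∧ ∀ i j, i < n → j < n → w i = w j → i = j

/-- The sequence `w 0, …, w (2 * t - 1)` is repetitively coloured by `f`. -/
def IsRepetitive (f : V → C) (t : ℕ) (w : ℕ → V) : Prop :=
  ∀ i, i < t → f (w i) = f (w (t + i))

/-- The sequence `w 0, …, w (2 * t - 1)` is boring. -/
def IsBoring (t : ℕ) (w : ℕ → V) : Prop :=
  ∀ i, i < t → w i = w (t + i)

/-- The colouring `f` is nonrepetitive on paths: no (nonempty) path is repetitively coloured. -/
def PathNonrepetitive (G : SimpleGraph V) (f : V → C) : Prop :=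
  ∀ (t : ℕ) (w : ℕ → V), 1 ≤ t → IsPathSeq G (2 * t) w → ¬ IsRepetitive f t w

/-- The colouring `f` is nonrepetitive on walks: every repetitively coloured walk is boring. -/
def WalkNonrepetitive (G : SimpleGraph V) (f : V → C) : Prop :=
  ∀ (t : ℕ) (w : ℕ → V), IsWalkSeq G (2 * t) w → IsRepetitive f t w → IsBoring t w

/-- `π(G)`: the minimum number of colours in a path-nonrepetitive colouring of `G`. -/
noncomputable def pathNumber (G : SimpleGraph V) : ℕ :=
  sInf {k : ℕ | ∃ f : V → Fin k, PathNonrepetitive G f}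

/-- `σ(G)`: the minimum number of colours in a walk-nonrepetitive colouring of `G`. -/
noncomputable def walkNumber (G : SimpleGraph V) : ℕ :=
  sInf {k : ℕ | ∃ f : V → Fin k, WalkNonrepetitive G f}

/-- A graph is chordal if every cycle on at least four vertices has a chord, that is, an edge
of the graph joining two vertices of the cycle that is not an edge of the cycle. -/
def IsChordal (H : SimpleGraph V) : Prop :=
  ∀ (a : V) (c : H.Walk a a), c.IsCycle → 4 ≤ c.length →
    ∃ x ∈ c.support, ∃ y ∈ c.support, H.Adj x y ∧ s(x, y) ∉ c.edges

/-- The treewidth of `G`: the minimum `k` such that `G` is a subgraph of a chordal graph with no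
clique on `k + 2` vertices. (The chordal graph may be taken on the vertex set of `G`, since induced
subgraphs of chordal graphs are chordal.) -/
noncomputable def treewidth (G : SimpleGraph V) : ℕ :=
  sInf {k : ℕ | ∃ H : SimpleGraph V, G ≤ H ∧ IsChordal H ∧ H.CliqueFree (k + 2)}

/-! The three minima are attained on finite graphs. -/

theorem WalkNonrepetitive.pathNonrepetitive {G : SimpleGraph V} {f : V → C}
    (h : WalkNonrepetitive G f) : PathNonrepetitive G f := by
  intro t w ht hp hr
  have := hp.2 0 (t + 0) (by omega) (by omega) (h t w hp.1 hr 0 (by omega))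
  omega

theorem exists_walkNonrepetitive [Finite V] (G : SimpleGraph V) :
    ∃ f : V → Fin (walkNumber G), WalkNonrepetitive G f := by
  refine Nat.sInf_mem (s := {k : ℕ | ∃ f : V → Fin k, WalkNonrepetitive G f}) ?_
  exact ⟨Nat.card V, Finite.equivFin V, fun t w _ hr i hi => (Finite.equivFin V).injective (hr i hi)⟩

theorem exists_pathNonrepetitive [Finite V] (G : SimpleGraph V) :
    ∃ f : V → Fin (pathNumber G), PathNonrepetitive G f := by
  refine Nat.sInf_mem (s := {k : ℕ | ∃ f : V → Fin k, PathNonrepetitive G f}) ?_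
  obtain ⟨f, hf⟩ := exists_walkNonrepetitive G
  exact ⟨_, f, hf.pathNonrepetitive⟩

theorem isChordal_top : IsChordal (⊤ : SimpleGraph V) := by
  intro a c hc hl
  have inj : ∀ i j, 1 ≤ i → i ≤ c.length → 1 ≤ j → j ≤ c.length →
      c.getVert i = c.getVert j → i = j := fun i j h1 h2 h3 h4 h =>
    hc.getVert_injOn (Set.mem_ofPred.2 ⟨h1, h2⟩) (Set.mem_ofPred.2 ⟨h3, h4⟩) h
  refine ⟨c.getVert 1, c.getVert_mem_support 1, c.getVert 3, c.getVert_mem_support 3, ?_, ?_⟩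
  · rw [SimpleGraph.top_adj]
    intro h
    have := inj 1 3 (by omega) (by omega) (by omega) (by omega) h
    omega
  · intro h
    obtain ⟨i, hi, he⟩ : ∃ i < c.length, s(c.getVert i, c.getVert (i + 1)) =
        s(c.getVert 1, c.getVert 3) :=
      (c.mk_mem_edges_iff_exists).1 h
    have h0 : c.getVert 0 = c.getVert c.length := by simp
    rcases Nat.eq_zero_or_pos i with rfl | hp
    · rw [h0, Sym2.eq_iff] at he
      rcases he with ⟨h1, h2⟩ | ⟨h1, h2⟩
      · have := inj _ _ (by omega) (by omega) (by omega) (by omega) h1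
        omega
      · have := inj _ _ (by omega) (by omega) (by omega) (by omega) h1
        omega
    · rw [Sym2.eq_iff] at he
      rcases he with ⟨h1, h2⟩ | ⟨h1, h2⟩ <;>
      · have := inj _ _ (by omega) (by omega) (by omega) (by omega) h1
        have := inj _ _ (by omega) (by omega) (by omega) (by omega) h2
        omega

theorem treewidth_spec [Finite V] (G : SimpleGraph V) :
    ∃ H : SimpleGraph V, G ≤ H ∧ IsChordal H ∧ H.CliqueFree (treewidth G + 2) := by
  refine Nat.sInf_mem
    (s := {k : ℕ | ∃ H : SimpleGraph V, G ≤ H ∧ IsChordal H ∧ H.CliqueFree (k + 2)}) ?_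
  have := Fintype.ofFinite V
  exact ⟨Fintype.card V, ⊤, le_top, isChordal_top, SimpleGraph.cliqueFree_of_card_lt (by omega)⟩

end NonRep

/-!
A graph is *layered* by a depth function under which adjacent vertices differ by at most one. The
*bag* of a vertex `v` is the set of vertices of the same depth that are joined to `v` without going
below it. Colour every vertex by its index within its bag and by the letter, at its depth, of a word
over four letters without squares and palindromes. Over such a word a repetitively coloured lazy
walk has equal halves, so corresponding vertices of a repetitively coloured walk have the same
depth; those of least depth lie in one bag and have the same index, so they coincide. No path is
thus coloured repetitively. Distinguishing in addition the vertices with a common neighbour makes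
one coincidence spread along the whole walk, which is then boring.

It remains to find a layering with bags of `O(kΔ)` vertices. Since `G` lies in a chordal graph with
cliques of at most `n = k + 1` vertices, every vertex set has a balanced separator of `n` vertices.
The layers are grown upwards: a lowest layer of at most `4n` vertices is followed by its
neighbours, at most `4nΔ` in number, while a larger one is first cut by a balanced separator, and
the resulting parts, in which its traces are much smaller, are layered separately and glued.
-/

namespace NonRep

section Words

variable {α : Type*}

/-- A word contains no square, that is, no two equal consecutive blocks of length `p ≥ 1`. -/
def SquareFree (w : ℕ → α) : Prop :=
  ∀ p i, 1 ≤ p → ¬ ∀ j < p, w (i + j) = w (i + j + p)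

/-- A word contains no overlap, that is, no square of period `p` followed by its own first
letter. -/
def OverlapFree (w : ℕ → α) : Prop :=
  ∀ p i, 1 ≤ p → ¬ ∀ j ≤ p, w (i + j) = w (i + j + p)

/-- A squarefree word without palindromes of length at least three. A palindrome in a squarefree
word has odd length, so it is enough to exclude palindromes of length three. -/
structure SquarePalindromeFree (w : ℕ → α) : Prop where
  squareFree : SquareFree w
  ne_add_two : ∀ n, w n ≠ w (n + 2)

theorem SquareFree.ne_succ {w : ℕ → α} (hw : SquareFree w) (n : ℕ) : w n ≠ w (n + 1) :=
  fun h => hw 1 n le_rfl fun j hj => by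
    obtain rfl : j = 0 := by omega
    exact h

theorem SquarePalindromeFree.eq_of_close {w : ℕ → α} (hw : SquarePalindromeFree w) {a b : ℕ}
    (h : w a = w b) (hab : a ≤ b + 2) (hba : b ≤ a + 2) : a = b := by
  by_contra hne
  obtain rfl | rfl | rfl | rfl : b = a + 1 ∨ b = a + 2 ∨ a = b + 1 ∨ a = b + 2 := by omega
  · exact hw.squareFree.ne_succ _ h
  · exact hw.ne_add_two _ h
  · exact hw.squareFree.ne_succ _ h.symm
  · exact hw.ne_add_two _ h.symm

/-- The Thue–Morse word: the parity of the number of ones in the binary expansion. -/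
def thueMorse : ℕ → Bool :=
  Nat.binaryRec false fun b _ t => b ^^ t

theorem thueMorse_bit (b : Bool) (n : ℕ) : thueMorse (Nat.bit b n) = (b ^^ thueMorse n) :=
  Nat.binaryRec_eq b n (.inl rfl)

theorem thueMorse_two_mul (n : ℕ) : thueMorse (2 * n) = thueMorse n := by
  simpa using thueMorse_bit false n

theorem thueMorse_two_mul_add_one (n : ℕ) : thueMorse (2 * n + 1) = !thueMorse n := by
  simpa using thueMorse_bit true n

theorem thueMorse_succ_of_even {n : ℕ} (hn : Even n) : thueMorse (n + 1) = !thueMorse n := by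
  obtain ⟨m, rfl⟩ := hn.exists_two_nsmul
  simp only [smul_eq_mul, thueMorse_two_mul, thueMorse_two_mul_add_one]

theorem thueMorse_eq_half {m n : ℕ} (hmod : m % 2 = n % 2) (h : thueMorse m = thueMorse n) :
    thueMorse (m / 2) = thueMorse (n / 2) := by
  obtain ⟨a, ha | ha⟩ := Nat.even_or_odd' m <;> obtain ⟨b, hb | hb⟩ := Nat.even_or_odd' n
  · rw [ha, hb, thueMorse_two_mul, thueMorse_two_mul] at h
    rwa [show m / 2 = a by omega, show n / 2 = b by omega]
  · omega
  · omega
  · rw [ha, hb, thueMorse_two_mul_add_one, thueMorse_two_mul_add_one, Bool.not_inj_iff] at h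
    rwa [show m / 2 = a by omega, show n / 2 = b by omega]

theorem thueMorse_overlap_half {q i : ℕ}
    (h : ∀ j ≤ 2 * q, thueMorse (i + j) = thueMorse (i + j + 2 * q)) :
    ∀ j ≤ q, thueMorse (i / 2 + j) = thueMorse (i / 2 + j + q) := by
  intro j hj
  have hhalf := thueMorse_eq_half (by omega) (h (2 * j) (by omega))
  rwa [show (i + 2 * j) / 2 = i / 2 + j by omega,
    show (i + 2 * j + 2 * q) / 2 = i / 2 + j + q by omega] at hhalf

/-- Of two positions at odd distance one is even, and there the next letter differs; so a word of
odd period would alternate, and its two ends would differ. -/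
theorem thueMorse_not_overlap_of_odd {p : ℕ} (hp : Odd p) (i : ℕ) :
    ¬ ∀ j ≤ p, thueMorse (i + j) = thueMorse (i + j + p) := by
  intro h
  have alternates : ∀ j < p, thueMorse (i + (j + 1)) = !thueMorse (i + j) := by
    intro j hj
    rcases Nat.even_or_odd (i + j) with heven | hodd
    · exact thueMorse_succ_of_even heven
    · rw [h (j + 1) hj, h j hj.le, show i + (j + 1) + p = i + j + p + 1 by ring]
      exact thueMorse_succ_of_even (hodd.add_odd hp)
  have parity : ∀ j ≤ p, thueMorse (i + j) = (decide (Odd j) ^^ thueMorse i) := by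
    intro j
    induction j with
    | zero => simp
    | succ j ih =>
      intro hj
      rw [alternates j hj, ih (by omega), ← Bool.not_xor]
      simp only [Nat.odd_add_one, decide_not]
  have ends : thueMorse (i + p) = !thueMorse i := by simpa [hp] using parity p le_rfl
  exact absurd ((h 0 p.zero_le).trans ends) (by simp)

theorem thueMorse_overlapFree : OverlapFree thueMorse := by
  intro p
  induction p using Nat.strong_induction_on with
  | _ p ih =>
    intro i hp h
    rcases Nat.even_or_odd' p with ⟨q, rfl | rfl⟩
    · exact ih q (by omega) (i / 2) (by omega) (thueMorse_overlap_half h)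
    · exact thueMorse_not_overlap_of_odd (odd_two_mul_add_one q) i h

/-- The comparisons record the differences of consecutive letters, so along a square of period `p`
the difference `w (n + p) - w n` is constant; as twice this constant is again a difference of two
letters, it vanishes. -/
theorem OverlapFree.squareFree_cmp {w : ℕ → Bool} (hw : OverlapFree w) :
    SquareFree fun n => cmp (w n) (w (n + 1)) := by
  have toInt_sub_eq : ∀ a b c d : Bool, cmp a b = cmp c d →
      d.toInt - b.toInt = c.toInt - a.toInt := by decide
  intro p i hp h
  have const : ∀ j ≤ p, (w (i + j + p)).toInt - (w (i + j)).toInt =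
      (w (i + p)).toInt - (w i).toInt := by
    intro j
    induction j with
    | zero => simp
    | succ j ih =>
      intro hj
      rw [← ih (by omega), ← add_assoc, add_right_comm (i + j) 1 p]
      exact toInt_sub_eq _ _ _ _ (h j hj)
  have zero : (w (i + p)).toInt - (w i).toInt = 0 := by
    have toInt_sub_eq_zero : ∀ a b c : Bool, c.toInt - b.toInt = b.toInt - a.toInt →
        b.toInt - a.toInt = 0 := by decide
    exact toInt_sub_eq_zero _ _ _ (const p le_rfl)
  have toInt_injective : ∀ a b : Bool, b.toInt - a.toInt = 0 → a = b := by decide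
  exact hw p i hp fun j hj => toInt_injective _ _ ((const j hj).trans zero)

/-- The word obtained from `w` by inserting the new letter `none` after every second letter. -/
def spread (w : ℕ → α) (n : ℕ) : Option α :=
  if n % 3 = 2 then none else some (w (2 * (n / 3) + n % 3))

theorem spread_eq_none_iff {w : ℕ → α} {n : ℕ} : spread w n = none ↔ n % 3 = 2 := by
  simp [spread]

theorem spread_mod_iff {w : ℕ → α} {m n : ℕ} (h : spread w m = spread w n) :
    m % 3 = 2 ↔ n % 3 = 2 := by
  rw [← spread_eq_none_iff (w := w), h, spread_eq_none_iff]

theorem eq_of_spread_eq {w : ℕ → α} {m n : ℕ} (h : spread w m = spread w n) (hm : m % 3 ≠ 2) :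
    w (2 * (m / 3) + m % 3) = w (2 * (n / 3) + n % 3) := by
  have hn : n % 3 ≠ 2 := (spread_mod_iff h).not.1 hm
  rwa [spread, spread, if_neg hm, if_neg hn, Option.some_inj] at h

theorem SquareFree.spread_ne_succ {w : ℕ → α} (hw : SquareFree w) (n : ℕ) :
    spread w n ≠ spread w (n + 1) := by
  intro h
  have hmod := spread_mod_iff h
  refine hw.ne_succ (2 * (n / 3) + n % 3) ((eq_of_spread_eq h (by omega)).trans ?_)
  congr 1
  omega

theorem SquareFree.spread_ne_add_two {w : ℕ → α} (hw : SquareFree w) (n : ℕ) :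
    spread w n ≠ spread w (n + 2) := by
  intro h
  have hmod := spread_mod_iff h
  refine hw.ne_succ (2 * (n / 3) + n % 3) ((eq_of_spread_eq h (by omega)).trans ?_)
  congr 1
  omega

/-- The inserted letters force the period of a square to be a multiple of three; deleting them
leaves a square of `w`. -/
theorem SquareFree.spread {w : ℕ → α} (hw : SquareFree w) : SquareFree (spread w) := by
  intro p i hp h
  have hp1 : p ≠ 1 := by
    rintro rfl
    exact hw.spread_ne_succ i (h 0 (by omega))
  have hp2 : p ≠ 2 := by
    rintro rfl
    exact hw.spread_ne_add_two i (h 0 (by omega))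
  have hp3 : p % 3 = 0 := by
    have := spread_mod_iff (h 0 (by omega))
    have := spread_mod_iff (h 1 (by omega))
    have := spread_mod_iff (h 2 (by omega))
    omega
  refine hw (2 * (p / 3)) (2 * (i / 3) + i % 3) (by omega) fun j hj => ?_
  obtain ⟨e, he⟩ : ∃ e, e = 2 * (i / 3) + i % 3 + j := ⟨_, rfl⟩
  have hletter := eq_of_spread_eq (h (3 * (e / 2) + e % 2 - i) (by omega)) (by omega)
  convert hletter using 2 <;> omega

theorem SquareFree.squarePalindromeFree_spread {w : ℕ → α} (hw : SquareFree w) :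
    SquarePalindromeFree (NonRep.spread w) :=
  ⟨hw.spread, hw.spread_ne_add_two⟩

theorem exists_squarePalindromeFree : ∃ w : ℕ → Option Ordering, SquarePalindromeFree w :=
  ⟨_, thueMorse_overlapFree.squareFree_cmp.squarePalindromeFree_spread⟩

end Words

theorem isBoring_of_iff_succ {V : Type*} {t : ℕ} {w : ℕ → V}
    (hstep : ∀ i, i + 1 < t → (w i = w (t + i) ↔ w (i + 1) = w (t + (i + 1))))
    (hex : ∃ i < t, w i = w (t + i)) : IsBoring t w := by
  have iff_zero : ∀ i < t, (w i = w (t + i) ↔ w 0 = w (t + 0)) := by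
    intro i
    induction i with
    | zero => simp
    | succ i ih => exact fun hi => (hstep i hi).symm.trans (ih (by omega))
  obtain ⟨i, hi, hwi⟩ := hex
  exact fun j hj => (iff_zero j hj).2 ((iff_zero i hi).1 hwi)

section LazyWalks

/-- A walk `x 0, …, x (n - 1)` on the one-way infinite path `ℕ` which may also stand still. -/
def IsLazyWalk (n : ℕ) (x : ℕ → ℕ) : Prop :=
  ∀ i, i + 1 < n → x i ≤ x (i + 1) + 1 ∧ x (i + 1) ≤ x i + 1

variable {α : Type*} {ℓ : ℕ → α} {n t : ℕ} {x y : ℕ → ℕ}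

theorem IsLazyWalk.mono {m : ℕ} (hx : IsLazyWalk n x) (hmn : m ≤ n) : IsLazyWalk m x :=
  fun i hi => hx i (by omega)

theorem IsLazyWalk.shift {m : ℕ} (hx : IsLazyWalk (m + n) x) :
    IsLazyWalk n fun i => x (m + i) :=
  fun i hi => hx (m + i) (by omega)

theorem IsLazyWalk.exists_eq {i j a : ℕ} (hx : IsLazyWalk n x) (hi : i < n) (hj : j < n)
    (hia : x i ≤ a) (haj : a ≤ x j) : ∃ k < n, x k = a := by
  have from_zero : ∀ m < n, x 0 ≤ a ∧ a ≤ x m ∨ x m ≤ a ∧ a ≤ x 0 → ∃ k < n, x k = a := by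
    intro m
    induction m with
    | zero => exact fun hm ha => ⟨0, hm, by omega⟩
    | succ m ih =>
      intro hm ha
      by_cases hma : x (m + 1) = a
      · exact ⟨m + 1, hm, hma⟩
      · have := hx m hm
        exact ih (by omega) (by omega)
  rcases le_total (x 0) a with h0 | h0
  · exact from_zero j hj (.inl ⟨h0, haj⟩)
  · exact from_zero i hi (.inr ⟨hia, h0⟩)

theorem IsLazyWalk.exists_adjacent {i j : ℕ} (hx : IsLazyWalk n x) (hi : i < n) (hj : j < n)
    (hne : x j ≠ x i) : ∃ k < n, x k + 1 = x i ∨ x k = x i + 1 := by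
  rcases Nat.lt_or_gt_of_ne hne with hlt | hgt
  · obtain ⟨k, hk, hxk⟩ := hx.exists_eq (a := x i - 1) hj hi (by omega) (by omega)
    exact ⟨k, hk, by omega⟩
  · obtain ⟨k, hk, hxk⟩ := hx.exists_eq (a := x i + 1) hi hj (by omega) (by omega)
    exact ⟨k, hk, by omega⟩

theorem SquarePalindromeFree.eq_iff_eq (hℓ : SquarePalindromeFree ℓ) {a b c d : ℕ}
    (hac : ℓ a = ℓ c) (hbd : ℓ b = ℓ d) (hab : a ≤ b + 2 ∧ b ≤ a + 2)
    (hcd : c ≤ d + 2 ∧ d ≤ c + 2) : a = b ↔ c = d := by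
  constructor
  · rintro rfl
    exact hℓ.eq_of_close (hac.symm.trans hbd) hcd.1 hcd.2
  · rintro rfl
    exact hℓ.eq_of_close (hac.trans hbd.symm) hab.1 hab.2

/-- Letters at distance at most two differ, so once one step of `x` has been matched with a step of
`y`, every further step of `y` is determined. -/
theorem SquarePalindromeFree.translate_or_reflect (hℓ : SquarePalindromeFree ℓ)
    (hx : IsLazyWalk t x) (hy : IsLazyWalk t y) (hxy : ∀ i < t, ℓ (x i) = ℓ (y i)) :
    (∀ i < t, y i + x 0 = x i + y 0) ∨ ∀ i < t, y i + x i = y 0 + x 0 := by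
  induction t with
  | zero => simp
  | succ t ih =>
    have ih := ih (hx.mono t.le_succ) (hy.mono t.le_succ) fun i hi => hxy i (by omega)
    rcases t with _ | t
    · left
      simp only [zero_add, Nat.lt_one_iff, forall_eq]
      exact add_comm _ _
    have stepx := hx t (by omega)
    have stepy := hy t (by omega)
    have last : x t = x (t + 1) ↔ y t = y (t + 1) :=
      hℓ.eq_iff_eq (hxy t (by omega)) (hxy (t + 1) (by omega)) (by omega) (by omega)
    simp only [Nat.forall_lt_succ_right (n := t + 1)]
    by_cases hconst : ∀ j < t + 1, x j = x t
    · have hx0 := hconst 0 (by omega)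
      have hyt : y t = y 0 := by
        rcases ih with h | h <;> have := h t (by omega) <;> omega
      have hyconst : ∀ j < t + 1, y j = y 0 := by
        intro j hj
        have := hconst j hj
        rcases ih with h | h <;> have := h j hj <;> omega
      obtain h | h : y (t + 1) + x 0 = x (t + 1) + y 0 ∨ y (t + 1) + x (t + 1) = y 0 + x 0 := by
        omega
      · exact .inl ⟨fun j hj => by rw [hyconst j hj, hconst j hj, hx0, add_comm], h⟩
      · exact .inr ⟨fun j hj => by rw [hyconst j hj, hconst j hj, hx0], h⟩
    · push Not at hconst
      obtain ⟨j, hj, hne⟩ := hconst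
      obtain ⟨k, hk, hadj⟩ := (hx.mono (t + 1).le_succ).exists_adjacent t.lt_succ_self hj hne
      refine ih.imp (fun h => ⟨h, ?_⟩) fun h => ⟨h, ?_⟩ <;>
      · have hk' := h k hk
        have ht' := h t t.lt_succ_self
        have := hℓ.eq_iff_eq (hxy k (by omega)) (hxy (t + 1) (by omega)) (by omega) (by omega)
        omega

theorem SquareFree.lazyWalk_add_one_lt (hℓ : SquareFree ℓ) (hx : IsLazyWalk n x) {p i j : ℕ}
    (hp : 1 ≤ p) (hperiod : ∀ k < n, ℓ (x k) = ℓ (x k + p)) (hi : i < n) (hj : j < n) :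
    x j + 1 < x i + p := by
  by_contra! hlong
  refine hℓ p (x i) hp fun m hm => ?_
  obtain ⟨k, hk, hxk⟩ := hx.exists_eq (a := x i + m) hi hj (by omega) (by omega)
  rw [← hxk, hperiod k hk]

/-- A reflected copy of `x` that starts where `x` ends meets `x` near the centre of the reflection;
a translated copy would let `x` traverse a square. -/
theorem SquarePalindromeFree.exists_lazyWalk_eq (hℓ : SquarePalindromeFree ℓ)
    (hx : IsLazyWalk (t + 1) x) (hy : IsLazyWalk (t + 1) y)
    (hxy : ∀ i < t + 1, ℓ (x i) = ℓ (y i)) (hlink : x t ≤ y 0 + 1 ∧ y 0 ≤ x t + 1) :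
    ∃ i < t + 1, x i = y i := by
  suffices hclose : ∃ i < t + 1, x i ≤ y i + 2 ∧ y i ≤ x i + 2 by
    obtain ⟨i, hi, h, h'⟩ := hclose
    exact ⟨i, hi, hℓ.eq_of_close (hxy i hi) h h'⟩
  by_contra! hfar
  have hfar0 := hfar 0 (by omega)
  rcases hℓ.translate_or_reflect hx hy hxy with htrans | hrefl
  · have ht := htrans t (by omega)
    rcases le_total (x 0) (y 0) with hle | hle
    · have := hℓ.squareFree.lazyWalk_add_one_lt hx (p := y 0 - x 0) (i := 0) (j := t) (by omega)
        (fun k hk => by rw [hxy k hk]; congr 1; have := htrans k hk; omega) (by omega) (by omega)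
      omega
    · have := hℓ.squareFree.lazyWalk_add_one_lt hy (p := x 0 - y 0) (i := t) (j := 0) (by omega)
        (fun k hk => by rw [← hxy k hk]; congr 1; have := htrans k hk; omega) (by omega) (by omega)
      omega
  · obtain ⟨i, hi, hxi⟩ : ∃ i < t + 1, x i = (x 0 + y 0) / 2 := by
      rcases le_total (x 0) (y 0) with hle | hle
      · exact hx.exists_eq (i := 0) (j := t) (by omega) (by omega) (by omega) (by omega)
      · exact hx.exists_eq (i := t) (j := 0) (by omega) (by omega) (by omega) (by omega)
    have := hrefl i hi
    have := hfar i hi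
    omega

theorem SquarePalindromeFree.isBoring_of_isLazyWalk (hℓ : SquarePalindromeFree ℓ)
    (hx : IsLazyWalk (2 * t) x) (hrep : IsRepetitive ℓ t x) : IsBoring t x := by
  rcases t with _ | t
  · exact fun i hi => absurd hi i.not_lt_zero
  rw [two_mul] at hx
  refine isBoring_of_iff_succ (fun i hi => ?_) ?_
  · have step := hx i (by omega)
    have step' := hx (t + 1 + i) (by omega)
    rw [add_assoc (t + 1)] at step'
    constructor <;> intro h <;> exact hℓ.eq_of_close (hrep _ (by omega)) (by omega) (by omega)
  · exact hℓ.exists_lazyWalk_eq (hx.mono (by omega)) hx.shift hrep (hx t (by omega))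

end LazyWalks

section Strolls

variable {V α β : Type*} {G H : SimpleGraph V} {B B' : Set V}

/-- The subgraph of `G` formed by the edges with both ends in `B`, on the same vertex type. -/
def within (G : SimpleGraph V) (B : Set V) : SimpleGraph V where
  Adj u v := G.Adj u v ∧ u ∈ B ∧ v ∈ B
  symm := ⟨fun _ _ h => ⟨h.1.symm, h.2.2, h.2.1⟩⟩
  loopless := ⟨fun _ h => G.loopless.irrefl _ h.1⟩

theorem within_mono (hGH : G ≤ H) (hB : B ⊆ B') : within G B ≤ within H B' :=
  fun _ _ h => ⟨hGH h.1, hB h.2.1, hB h.2.2⟩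

theorem mem_and_reachable_within_of_closed {u v : V} (h : (within G B).Reachable u v)
    (hu : u ∈ B') (hclosed : ∀ a ∈ B', ∀ b ∈ B, G.Adj a b → b ∈ B') :
    v ∈ B' ∧ (within G B').Reachable u v := by
  rw [SimpleGraph.reachable_iff_reflTransGen] at h
  induction h with
  | refl => exact ⟨hu, .rfl⟩
  | @tail a b _ hab ih =>
    have hb : b ∈ B' := hclosed a ih.1 b hab.2.2 hab.1
    exact ⟨hb, ih.2.trans (SimpleGraph.Adj.reachable ⟨hab.1, ih.1, hb⟩)⟩

theorem IsWalkSeq.reachable_within {n : ℕ} {w : ℕ → V} (hw : IsWalkSeq G n w)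
    (hB : ∀ i < n, w i ∈ B) {i j : ℕ} (hij : i ≤ j) (hj : j < n) :
    (within G B).Reachable (w i) (w j) := by
  induction j, hij using Nat.le_induction with
  | base => exact .rfl
  | succ j _ ih =>
    exact (ih (by omega)).trans (SimpleGraph.Adj.reachable ⟨hw j hj, hB _ (by omega), hB _ hj⟩)

/-- Every repetitively coloured walk meets itself at some pair of corresponding vertices. Walks of
even length without such a pair are called strolls. -/
def StrollNonrepetitive (G : SimpleGraph V) (f : V → α) : Prop :=
  ∀ (t : ℕ) (w : ℕ → V), 1 ≤ t → IsWalkSeq G (2 * t) w → IsRepetitive f t w →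
    ∃ i < t, w i = w (t + i)

theorem StrollNonrepetitive.pathNonrepetitive {f : V → α} (hf : StrollNonrepetitive G f) :
    PathNonrepetitive G f := by
  intro t w ht hw hrep
  obtain ⟨i, hi, hwi⟩ := hf t w ht hw.1 hrep
  have := hw.2 i (t + i) (by omega) (by omega) hwi
  omega

theorem StrollNonrepetitive.walkNonrepetitive {f : V → α} {g : V → β}
    (hf : StrollNonrepetitive G f) (hg : ∀ v, (G.neighborSet v).InjOn g) :
    WalkNonrepetitive G fun v => (f v, g v) := by
  intro t w hw hrep
  rcases Nat.eq_zero_or_pos t with rfl | ht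
  · exact fun i hi => absurd hi i.not_lt_zero
  have hrepg : IsRepetitive g t w := fun i hi => congrArg Prod.snd (hrep i hi)
  refine isBoring_of_iff_succ (fun i hi => ?_)
    (hf t w ht hw fun i hi => congrArg Prod.fst (hrep i hi))
  have step := hw i (by omega)
  have step' := hw (t + i) (by omega)
  constructor <;> intro h
  · exact hg (w i) step (h ▸ step') (hrepg _ hi)
  · exact hg (w (i + 1)) step.symm (h ▸ step'.symm) (hrepg _ (by omega))

/-- The bag of `v` in the layering `d` of `G[A]`: the vertices of `A` in the layer of `v` that are
joined to `v` without passing through lower layers. -/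
def bag (G : SimpleGraph V) (A : Set V) (d : V → ℕ) (v : V) : Set V :=
  {u | u ∈ A ∧ d u = d v ∧ (within G {z | z ∈ A ∧ d v ≤ d z}).Reachable v u}

/-- The layers visited by a repetitively coloured walk form a lazy walk with equal halves, and
corresponding vertices of its lowest layer lie in the same bag. -/
theorem strollNonrepetitive_of_layering {ℓ : ℕ → α} (hℓ : SquarePalindromeFree ℓ) {d : V → ℕ}
    {g : V → β} (hd : ∀ u v, G.Adj u v → d u ≤ d v + 1)
    (hg : ∀ v, ∀ u ∈ bag G Set.univ d v, g u = g v → u = v) :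
    StrollNonrepetitive G fun v => (ℓ (d v), g v) := by
  intro t w ht hw hrep
  have hlevels : IsBoring t fun i => d (w i) := hℓ.isBoring_of_isLazyWalk
    (fun i hi => ⟨hd _ _ (hw i hi), hd _ _ (hw i hi).symm⟩)
    (fun i hi => congrArg Prod.fst (hrep i hi))
  obtain ⟨j, hj, hlowest⟩ := Finset.exists_min_image (Finset.range t) (fun i => d (w i))
    ⟨0, Finset.mem_range.2 ht⟩
  simp only [Finset.mem_range] at hj hlowest
  have habove : ∀ i < 2 * t, w i ∈ {z | z ∈ Set.univ ∧ d (w j) ≤ d z} := by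
    refine fun i hi => ⟨trivial, ?_⟩
    rcases Nat.lt_or_ge i t with hit | hit
    · exact hlowest i hit
    · have hlevel := hlevels (i - t) (by omega)
      simp only [Nat.add_sub_cancel' hit] at hlevel
      exact hlevel ▸ hlowest (i - t) (by omega)
  have hbag : w (t + j) ∈ bag G Set.univ d (w j) :=
    ⟨trivial, (hlevels j hj).symm, hw.reachable_within habove (by omega) (by omega)⟩
  exact ⟨j, hj, (hg _ _ hbag (congrArg Prod.snd (hrep j hj)).symm).symm⟩

end Strolls

section Colouring

variable {V : Type*} [Finite V] {G : SimpleGraph V}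

theorem exists_forall_adj_ne {m : ℕ} {v : V} (hv : (G.neighborSet v).ncard < m) (g : V → Fin m) :
    ∃ c, ∀ u, G.Adj v u → g u ≠ c := by
  by_contra! hall
  have hcard : (g '' G.neighborSet v).ncard < m := (Set.ncard_image_le (Set.toFinite _)).trans_lt hv
  rw [Set.eq_univ_of_forall (s := g '' G.neighborSet v) hall, Set.ncard_univ, Nat.card_fin] at hcard
  exact hcard.ne rfl

theorem colorable_of_ncard_neighborSet_lt {m : ℕ} (h : ∀ v, (G.neighborSet v).ncard < m) :
    G.Colorable m := by
  classical
  suffices hset : ∀ s : Set V, ∃ g : V → Fin m, ∀ u ∈ s, ∀ v ∈ s, G.Adj u v → g u ≠ g v by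
    obtain ⟨g, hg⟩ := hset Set.univ
    exact ⟨.mk g fun {u v} => hg u trivial v trivial⟩
  intro s
  induction s, Set.toFinite s using Set.Finite.induction_on with
  | empty => exact ⟨fun v => ⟨0, (Nat.zero_le _).trans_lt (h v)⟩, by simp⟩
  | @insert a s _ _ ih =>
    obtain ⟨g, hg⟩ := ih
    obtain ⟨c, hc⟩ := exists_forall_adj_ne (h a) g
    refine ⟨Function.update g a c, fun u hu v hv huv => ?_⟩
    rcases eq_or_ne u a with rfl | hua
    · rw [Function.update_self, Function.update_of_ne huv.ne']
      exact (hc v huv).symm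
    rcases eq_or_ne v a with rfl | hva
    · rw [Function.update_self, Function.update_of_ne hua]
      exact hc u huv.symm
    · rw [Function.update_of_ne hua, Function.update_of_ne hva]
      exact hg u (hu.resolve_left hua) v (hv.resolve_left hva) huv

theorem exists_injective_on_bags {d : V → ℕ} {W : ℕ}
    (hW : ∀ v, (bag G Set.univ d v).ncard ≤ W) :
    ∃ g : V → Fin W, ∀ v, ∀ u ∈ bag G Set.univ d v, g u = g v → u = v := by
  let sameBag : SimpleGraph V :=
    { Adj := fun v u => u ∈ bag G Set.univ d v ∧ u ≠ v
      symm := ⟨fun v u ⟨⟨_, hd, hr⟩, hne⟩ => ⟨⟨trivial, hd.symm, hd ▸ hr.symm⟩, hne.symm⟩⟩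
      loopless := ⟨fun _ h => h.2 rfl⟩ }
  have hdeg : ∀ v, (sameBag.neighborSet v).ncard < W := fun v => by
    have hv : v ∈ bag G Set.univ d v := ⟨trivial, rfl, .rfl⟩
    have hsub : sameBag.neighborSet v ⊂ bag G Set.univ d v :=
      (Set.ssubset_iff_of_subset fun _ hu => hu.1).2 ⟨v, hv, sameBag.irrefl⟩
    exact (Set.ncard_lt_ncard hsub).trans_le (hW v)
  obtain ⟨g⟩ := colorable_of_ncard_neighborSet_lt hdeg
  exact ⟨g, fun v u hu huv => by_contra fun hne => g.valid (v := v) (w := u) ⟨hu, hne⟩ huv.symm⟩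

theorem ncard_biUnion_neighborSet_le {Δ : ℕ} (hΔ : ∀ v, (G.neighborSet v).ncard ≤ Δ) (S : Set V) :
    (⋃ v ∈ S, G.neighborSet v).ncard ≤ S.ncard * Δ := by
  classical
  have := Fintype.ofFinite V
  calc (⋃ v ∈ S, G.neighborSet v).ncard
      ≤ ∑ v ∈ S.toFinset, (G.neighborSet v).ncard := by
        simpa using S.toFinset.set_ncard_biUnion_le G.neighborSet
    _ ≤ S.ncard * Δ := by
        rw [Set.ncard_eq_toFinset_card', ← smul_eq_mul]
        exact Finset.sum_le_card_nsmul _ _ _ fun v _ => hΔ v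

theorem exists_injOn_neighborSet {Δ : ℕ} (hΔ : ∀ v, (G.neighborSet v).ncard ≤ Δ) :
    ∃ g : V → Fin (Δ ^ 2 + 1), ∀ v, (G.neighborSet v).InjOn g := by
  let haveCommonNeighbor : SimpleGraph V :=
    { Adj := fun u v => u ≠ v ∧ ∃ a, G.Adj u a ∧ G.Adj a v
      symm := ⟨fun u v ⟨hne, a, hu, hv⟩ => ⟨hne.symm, a, hv.symm, hu.symm⟩⟩
      loopless := ⟨fun _ h => h.1 rfl⟩ }
  have hdeg : ∀ v, (haveCommonNeighbor.neighborSet v).ncard < Δ ^ 2 + 1 := fun v => by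
    have hsub : haveCommonNeighbor.neighborSet v ⊆ ⋃ a ∈ G.neighborSet v, G.neighborSet a :=
      fun u ⟨_, a, hva, hau⟩ => Set.mem_biUnion hva hau
    calc (haveCommonNeighbor.neighborSet v).ncard
        ≤ (⋃ a ∈ G.neighborSet v, G.neighborSet a).ncard := Set.ncard_le_ncard hsub
      _ ≤ (G.neighborSet v).ncard * Δ := ncard_biUnion_neighborSet_le hΔ _
      _ ≤ Δ * Δ := Nat.mul_le_mul_right Δ (hΔ v)
      _ < Δ ^ 2 + 1 := by rw [pow_two]; exact Nat.lt_succ_self _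
  obtain ⟨g⟩ := colorable_of_ncard_neighborSet_lt hdeg
  exact ⟨g, fun a u hu v hv huv => by_contra fun hne =>
    g.valid (v := u) (w := v) ⟨hne, a, hu.symm, hv⟩ huv⟩

end Colouring

section InducedPaths

variable {V : Type*} {H : SimpleGraph V} {B : Set V} {u v x y z : V}

/-- An induced path: one such that every edge of `H` between two of its vertices is an edge of the
path. -/
structure IsInducedPath (q : H.Walk u v) : Prop where
  isPath : q.IsPath
  isChordless : q.IsChordless

theorem isInducedPath_nil : IsInducedPath (.nil : H.Walk u u) := by
  refine ⟨.nil, SimpleGraph.Walk.isChordless_iff_forall_mem_edges.2 fun a b ha hb hab => ?_⟩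
  simp only [SimpleGraph.Walk.support_nil, List.mem_singleton] at ha hb
  exact absurd (ha.trans hb.symm) hab.ne

theorem IsInducedPath.cons {q : H.Walk u v} (hq : IsInducedPath q) (h : H.Adj y u)
    (hy : y ∉ q.support) (honly : ∀ a ∈ q.support, H.Adj y a → a = u) :
    IsInducedPath (q.cons h) := by
  refine ⟨hq.isPath.cons hy,
    SimpleGraph.Walk.isChordless_iff_forall_mem_edges.2 fun a b ha hb hab => ?_⟩
  rw [SimpleGraph.Walk.support_cons, List.mem_cons] at ha hb
  rw [SimpleGraph.Walk.edges_cons, List.mem_cons]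
  rcases ha with rfl | ha <;> rcases hb with rfl | hb
  · exact absurd rfl hab.ne
  · exact .inl (by rw [honly b hb hab])
  · exact .inl (by rw [honly a ha hab.symm, Sym2.eq_swap])
  · exact .inr (hq.isChordless.mem_edges ha hb hab)

theorem IsInducedPath.of_cons {q : H.Walk u v} {h : H.Adj y u} (hq : IsInducedPath (q.cons h)) :
    IsInducedPath q := by
  obtain ⟨hpath, hy⟩ := (SimpleGraph.Walk.cons_isPath_iff h q).1 hq.isPath
  refine ⟨hpath, SimpleGraph.Walk.isChordless_iff_forall_mem_edges.2 fun a b ha hb hab => ?_⟩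
  have hmem := hq.isChordless.mem_edges (List.mem_cons_of_mem _ ha) (List.mem_cons_of_mem _ hb) hab
  rw [SimpleGraph.Walk.edges_cons, List.mem_cons] at hmem
  refine hmem.resolve_left fun heq => ?_
  rcases Sym2.eq_iff.1 heq with ⟨rfl, -⟩ | ⟨-, rfl⟩
  · exact hy ha
  · exact hy hb

theorem IsInducedPath.exists_of_adj {q : H.Walk u v} (hq : IsInducedPath q)
    (hy : y ∈ q.support ∨ ∃ a ∈ q.support, H.Adj y a) :
    ∃ q' : H.Walk y v, IsInducedPath q' ∧ ∀ a ∈ q'.support, a = y ∨ a ∈ q.support := by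
  induction q with
  | @nil u =>
    rcases hy with hmem | ⟨a, ha, hya⟩
    · obtain rfl : y = u := by simpa using hmem
      exact ⟨.nil, hq, fun a ha => .inr ha⟩
    · obtain rfl : a = u := by simpa using ha
      exact ⟨.cons hya .nil, hq.cons hya (by simpa using hya.ne) (by simp), by simp⟩
  | @cons u b v h q ih =>
    by_cases htail : y ∈ q.support ∨ ∃ a ∈ q.support, H.Adj y a
    · obtain ⟨q', hq', hsupp⟩ := ih hq.of_cons htail
      exact ⟨q', hq', fun a ha => (hsupp a ha).imp_right (List.mem_cons_of_mem _)⟩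
    push Not at htail
    have hadj : ∀ a ∈ (q.cons h).support, H.Adj y a → a = u := fun a ha hya => by
      rcases List.mem_cons.1 ha with rfl | ha
      · rfl
      · exact absurd hya (htail.2 a ha)
    by_cases hyu : y = u
    · subst hyu
      exact ⟨q.cons h, hq, fun a ha => .inr ha⟩
    have hmem : y ∉ (q.cons h).support := by simpa using ⟨hyu, htail.1⟩
    obtain ⟨a, ha, hya⟩ := hy.resolve_left hmem
    obtain rfl := hadj a ha hya
    exact ⟨(q.cons h).cons hya, hq.cons hya hmem hadj, fun a ha => List.mem_cons.1 ha⟩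

/-- The first neighbour of `x` along a path ends a shorter induced path. -/
theorem exists_isInducedPath_to_neighbor (h : (within H B).Reachable v z) (hv : v ∈ B)
    (hxz : H.Adj x z) : ∃ (z' : V) (q : H.Walk v z'), IsInducedPath q ∧ (∀ a ∈ q.support, a ∈ B) ∧
      H.Adj x z' ∧ ∀ a ∈ q.support, H.Adj x a → a = z' := by
  rw [SimpleGraph.reachable_iff_reflTransGen] at h
  induction h using Relation.ReflTransGen.head_induction_on with
  | refl => exact ⟨z, .nil, isInducedPath_nil, by simpa, hxz, by simp⟩
  | @head v u hvu _ ih =>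
    obtain ⟨z', q, hq, hqB, hxz', honly⟩ := ih hvu.2.2
    by_cases hxv : H.Adj x v
    · exact ⟨v, .nil, isInducedPath_nil, by simpa, hxv, by simp⟩
    obtain ⟨q', hq', hsupp⟩ := hq.exists_of_adj (.inr ⟨u, q.start_mem_support, hvu.1⟩)
    refine ⟨z', q', hq', fun a ha => ?_, hxz', fun a ha hxa => ?_⟩ <;>
      rcases hsupp a ha with rfl | ha
    · exact hv
    · exact hqB a ha
    · exact absurd hxa hxv
    · exact honly a ha hxa

theorem isCycle_cons_concat {q : H.Walk u v} (hq : q.IsPath) (huv : u ≠ v) (hx : x ∉ q.support)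
    (hxu : H.Adj x u) (hvx : H.Adj v x) : ((q.concat hvx).cons hxu).IsCycle := by
  rw [SimpleGraph.Walk.cons_isCycle_iff, SimpleGraph.Walk.edges_concat, List.concat_eq_append,
    List.mem_append, List.mem_singleton]
  refine ⟨hq.concat hx hvx, ?_⟩
  rintro (h | h)
  · exact hx (q.fst_mem_support_of_mem_edges h)
  · rcases Sym2.eq_iff.1 h with ⟨-, rfl⟩ | ⟨-, h⟩
    · exact hxu.ne rfl
    · exact huv h

theorem IsChordal.exists_adj_of_isInducedPath (hH : IsChordal H) {q : H.Walk u v}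
    (hq : IsInducedPath q) (hlen : 2 ≤ q.length) (hx : x ∉ q.support) (hxu : H.Adj x u)
    (hvx : H.Adj v x) : ∃ a ∈ q.support, a ≠ u ∧ a ≠ v ∧ H.Adj x a := by
  by_contra! hno
  have huv : u ≠ v := by
    rintro rfl
    have hnil := SimpleGraph.Walk.isPath_iff_nil.1 hq.isPath
    have hzero := SimpleGraph.Walk.length_eq_zero_iff.2 hnil
    omega
  have hsupport : ∀ a ∈ ((q.concat hvx).cons hxu).support, a = x ∨ a ∈ q.support := by
    simp [SimpleGraph.Walk.support_concat, or_comm]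
  have hedges : ∀ e, e ∈ ((q.concat hvx).cons hxu).edges ↔
      e = s(x, u) ∨ e ∈ q.edges ∨ e = s(v, x) := by
    simp [SimpleGraph.Walk.edges_concat]
  have hxedge : ∀ a ∈ q.support, H.Adj x a → s(x, a) ∈ ((q.concat hvx).cons hxu).edges := by
    intro a ha hxa
    rw [hedges]
    by_cases hau : a = u
    · exact .inl (hau ▸ rfl)
    by_cases hav : a = v
    · exact .inr (.inr (hav ▸ Sym2.eq_swap))
    exact absurd hxa (hno a ha hau hav)
  obtain ⟨a, ha, b, hb, hab, hchord⟩ := hH x _ (isCycle_cons_concat hq.isPath huv hx hxu hvx)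
    (by simp; omega)
  rcases hsupport a ha with rfl | haq <;> rcases hsupport b hb with rfl | hbq
  · exact hab.ne rfl
  · exact hchord (hxedge b hbq hab)
  · exact hchord (Sym2.eq_swap ▸ hxedge a haq hab.symm)
  · exact hchord ((hedges _).2 (.inr (.inl (hq.isChordless.mem_edges haq hbq hab))))

theorem IsChordal.adj_end_of_isInducedPath (hH : IsChordal H) {q : H.Walk u z}
    (hq : IsInducedPath q) (hx : x ∉ q.support) (hy : y ∉ q.support) (hxy : H.Adj x y)
    (hxz : H.Adj x z) (honly : ∀ a ∈ q.support, H.Adj x a → a = z)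
    (hya : ∃ a ∈ q.support, H.Adj y a) : H.Adj y z := by
  induction q with
  | nil => simpa using hya
  | @cons u b z h q ih =>
    rw [SimpleGraph.Walk.support_cons, List.mem_cons, not_or] at hx hy
    by_cases htail : ∃ a ∈ q.support, H.Adj y a
    · exact ih hq.of_cons hx.2 hy.2 hxz (fun a ha => honly a (List.mem_cons_of_mem _ ha)) htail
    push Not at htail
    have hyu : H.Adj y u := by
      obtain ⟨a, ha, hya⟩ := hya
      rcases List.mem_cons.1 ha with rfl | ha
      · exact hya
      · exact absurd hya (htail a ha)
    have hind : IsInducedPath ((q.cons h).cons hyu) :=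
      hq.cons hyu (by simpa using hy) fun a ha hya => by
        rcases List.mem_cons.1 ha with rfl | ha
        · rfl
        · exact absurd hya (htail a ha)
    obtain ⟨a, ha, hay, haz, hxa⟩ := hH.exists_adj_of_isInducedPath hind (by simp)
      (by simpa using ⟨hxy.ne, hx⟩) hxy hxz.symm
    rcases List.mem_cons.1 ha with rfl | ha
    · exact absurd rfl hay
    · exact absurd (honly a ha hxa) haz

theorem IsChordal.exists_common_neighbor (hH : IsChordal H) {K : Set V} (hK : H.IsClique K)
    (hfin : K.Finite) (hB : B.Nonempty) (hconn : ∀ u ∈ B, ∀ v ∈ B, (within H B).Reachable u v)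
    (hdisj : Disjoint K B) (hnbr : ∀ x ∈ K, ∃ u ∈ B, H.Adj x u) :
    ∃ v ∈ B, ∀ x ∈ K, H.Adj x v := by
  induction K, hfin using Set.Finite.induction_on with
  | empty => exact hB.imp fun v hv => ⟨hv, by simp⟩
  | @insert x K _ _ ih =>
    rw [Set.disjoint_insert_left] at hdisj
    obtain ⟨v, hv, hKv⟩ := ih (hK.subset (Set.subset_insert x K)) hdisj.2
      fun y hy => hnbr y (Set.mem_insert_of_mem x hy)
    obtain ⟨w, hw, hxw⟩ := hnbr x (Set.mem_insert x K)
    obtain ⟨z, q, hq, hqB, hxz, honly⟩ :=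
      exists_isInducedPath_to_neighbor (hconn v hv w hw) hv hxw
    have hyq : ∀ y ∈ K, y ∉ q.support := fun y hy hmem =>
      Set.disjoint_left.1 hdisj.2 hy (hqB y hmem)
    refine ⟨z, hqB z q.end_mem_support, fun y hy => ?_⟩
    rcases Set.mem_insert_iff.1 hy with rfl | hyK
    · exact hxz
    by_cases hyx : y = x
    · exact hyx ▸ hxz
    · exact hH.adj_end_of_isInducedPath hq (fun hmem => hdisj.1 (hqB x hmem)) (hyq y hyK)
        (hK (Set.mem_insert x K) hy (Ne.symm hyx)) hxz honly ⟨v, q.start_mem_support, hKv y hyK⟩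

end InducedPaths

section Separators

variable {V : Type*} {G H : SimpleGraph V} {X : Set V} {u v : V}

/-- The vertex set of the connected component of `v` in `G - X`, for `v ∉ X`. -/
def component (G : SimpleGraph V) (X : Set V) (v : V) : Set V :=
  {u | (within G Xᶜ).Reachable v u}

theorem mem_component_self (G : SimpleGraph V) (X : Set V) (v : V) : v ∈ component G X v :=
  SimpleGraph.Reachable.refl v

theorem component_eq_of_mem (hu : u ∈ component G X v) : component G X u = component G X v :=
  Set.ext fun _ => ⟨hu.trans, hu.symm.trans⟩

theorem component_subset_compl (hv : v ∉ X) : component G X v ⊆ Xᶜ :=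
  fun _ hu => (mem_and_reachable_within_of_closed hu hv fun _ _ _ hb _ => hb).1

theorem mem_component_of_adj {a b : V} (hv : v ∉ X) (ha : a ∈ component G X v) (hb : b ∉ X)
    (hab : G.Adj a b) : b ∈ component G X v :=
  SimpleGraph.Reachable.trans ha
    (SimpleGraph.Adj.reachable ⟨hab, component_subset_compl hv ha, hb⟩)

theorem component_subset_of_closed {A : Set V} (hv : v ∈ A)
    (hclosed : ∀ a ∈ A, ∀ b ∉ X, G.Adj a b → b ∈ A) : component G X v ⊆ A :=
  fun _ hu => (mem_and_reachable_within_of_closed hu hv hclosed).1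

theorem reachable_within_component (hv : v ∉ X) {a b : V} (ha : a ∈ component G X v)
    (hb : b ∈ component G X v) : (within G (component G X v)).Reachable a b := by
  have hreach : ∀ c ∈ component G X v, (within G (component G X v)).Reachable v c := fun c hc =>
    (mem_and_reachable_within_of_closed hc (mem_component_self G X v)
      fun _ ha _ hb => mem_component_of_adj hv ha hb).2
  exact (hreach a ha).symm.trans (hreach b hb)

/-- The clique `X'` consists of the vertices of `X` with a neighbour in the component and of a
common neighbour of them in the component. -/
theorem IsChordal.exists_isClique_component_ssubset (hH : IsChordal H) (hX : H.IsClique X)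
    (hfin : X.Finite) (hv : v ∉ X) :
    ∃ X' : Set V, H.IsClique X' ∧ ∀ v' ∉ X', (component H X' v' ∩ component H X v).Nonempty →
      component H X' v' ⊂ component H X v := by
  set B := component H X v
  set K := {x | x ∈ X ∧ ∃ u ∈ B, H.Adj x u}
  have hKX : K ⊆ X := fun x hx => hx.1
  obtain ⟨w, hw, hKw⟩ := hH.exists_common_neighbor (hX.subset hKX) (hfin.subset hKX)
    ⟨v, mem_component_self H X v⟩ (fun _ ha _ hb => reachable_within_component hv ha hb)
    (Set.disjoint_left.2 fun x hx hxB => component_subset_compl hv hxB (hKX hx)) fun x hx => hx.2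
  refine ⟨insert w K, SimpleGraph.isClique_insert.2
    ⟨hX.subset hKX, fun x hx _ => (hKw x hx).symm⟩, fun v' hv' ⟨a, hav', haB⟩ => ?_⟩
  have hsub : component H (insert w K) v' ⊆ B := by
    rw [← component_eq_of_mem hav']
    refine component_subset_of_closed haB fun b hb c hc hbc => mem_component_of_adj hv hb ?_ hbc
    exact fun hcX => hc (Set.mem_insert_of_mem w ⟨hcX, b, hb, hbc.symm⟩)
  exact ⟨hsub, fun h => component_subset_compl hv' (h hw) (Set.mem_insert w K)⟩

theorem ncard_le_of_isClique_of_cliqueFree {n : ℕ} (hX : H.IsClique X)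
    (hfree : H.CliqueFree (n + 1)) : X.ncard ≤ n := by
  by_contra! hn
  obtain ⟨Y, hYX, hY⟩ := Set.exists_subset_card_eq hn
  have hfin : Y.Finite := Set.finite_of_ncard_ne_zero (by omega)
  refine hfree hfin.toFinset ⟨?_, ?_⟩
  · rw [hfin.coe_toFinset]
    exact hX.subset hYX
  · rw [← Set.ncard_eq_toFinset_card Y hfin, hY]

/-- Every vertex set `S` has a balanced separator of at most `n` vertices: no component left after
deleting it contains more than half of `S`. -/
def HasSeparators (G : SimpleGraph V) (n : ℕ) : Prop :=
  ∀ S : Set V, ∃ X : Set V, X.ncard ≤ n ∧ ∀ v ∉ X, 2 * (S ∩ component G X v).ncard ≤ S.ncard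

theorem HasSeparators.mono [Finite V] {n : ℕ} (h : HasSeparators H n) (hGH : G ≤ H) :
    HasSeparators G n := by
  intro S
  obtain ⟨X, hXn, hX⟩ := h S
  refine ⟨X, hXn, fun v hv => le_trans ?_ (hX v hv)⟩
  have hsub : S ∩ component G X v ⊆ S ∩ component H X v :=
    Set.inter_subset_inter_right S fun _ hu => hu.mono (within_mono hGH subset_rfl)
  exact Nat.mul_le_mul_left 2 (Set.ncard_le_ncard hsub)

/-- A clique and a component containing more than half of `S`, with the component as small as
possible: the heavy component left by the next clique meets it, hence is smaller. -/
theorem IsChordal.hasSeparators [Finite V] (hH : IsChordal H) {n : ℕ}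
    (hfree : H.CliqueFree (n + 1)) : HasSeparators H n := by
  intro S
  by_contra! hcon
  have hheavy : ∀ X : Set V, H.IsClique X → ∃ v ∉ X, S.ncard < 2 * (S ∩ component H X v).ncard :=
    fun X hX => hcon X (ncard_le_of_isClique_of_cliqueFree hX hfree)
  obtain ⟨v₀, hv₀, hS₀⟩ := hheavy ∅ (by simp)
  obtain ⟨⟨X, v⟩, ⟨hX, hv, hS⟩, hmin⟩ := Set.exists_min_image
    {Y : Set V × V | H.IsClique Y.1 ∧ Y.2 ∉ Y.1 ∧ S.ncard < 2 * (S ∩ component H Y.1 Y.2).ncard}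
    (fun Y => (component H Y.1 Y.2).ncard) (Set.toFinite _) ⟨(∅, v₀), by simp, hv₀, hS₀⟩
  dsimp only at hX hv hS hmin
  obtain ⟨X', hX', hsmaller⟩ := hH.exists_isClique_component_ssubset hX X.toFinite hv
  obtain ⟨v', hv', hS'⟩ := hheavy X' hX'
  have hmeet : ((S ∩ component H X' v') ∩ (S ∩ component H X v)).Nonempty := by
    by_contra! hempty
    have hunion := Set.ncard_union_eq (Set.disjoint_iff_inter_eq_empty.2 hempty)
    have hle : (S ∩ component H X' v' ∪ S ∩ component H X v).ncard ≤ S.ncard :=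
      Set.ncard_le_ncard (Set.union_subset Set.inter_subset_left Set.inter_subset_left)
    omega
  have hlt := Set.ncard_lt_ncard (hsmaller v' hv' (hmeet.mono fun _ h => ⟨h.1.2, h.2.2⟩))
  exact hlt.not_ge (hmin (X', v') ⟨hX', hv', hS'⟩)

end Separators

section Layerings

variable {V ι : Type*} {G : SimpleGraph V} {A S N X : Set V} {comp : V → ι} {r r' W : ℕ}
  {d : V → ℕ}

/-- `d` is a layering of `G[A]` whose lowest layer contains `S` and has at most `r` vertices, and
all of whose bags have at most `W` vertices. -/
structure IsLayering (G : SimpleGraph V) (A S : Set V) (r W : ℕ) (d : V → ℕ) : Prop where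
  adj : ∀ u ∈ A, ∀ v ∈ A, G.Adj u v → d u ≤ d v + 1
  root : ∀ u ∈ S, d u = 0
  root_card : {u | u ∈ A ∧ d u = 0}.ncard ≤ r
  bag_card : ∀ v ∈ A, (bag G A d v).ncard ≤ W

theorem IsLayering.shift (h : IsLayering G A S r W d) (r' : ℕ) :
    IsLayering G A ∅ r' W fun v => d v + 1 where
  adj u hu v hv huv := Nat.add_le_add_right (h.adj u hu v hv huv) 1
  root _ hu := hu.elim
  root_card := by simp
  bag_card v hv := by simpa [bag] using h.bag_card v hv

/-- The part of `A` with label `c`, when the vertices outside the separator `X` are labelled by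
their components; every part contains `A ∩ X`. -/
def part (X : Set V) (comp : V → ι) (A : Set V) (c : ι) : Set V :=
  {u | u ∈ A ∧ (u ∈ X ∨ comp u = c)}

theorem part_mono (h : S ⊆ A) (c : ι) : part X comp S c ⊆ part X comp A c :=
  fun _ hu => ⟨h hu.1, hu.2⟩

variable [Finite V]

theorem IsLayering.cons (h : IsLayering G (A \ S) N r' W d)
    (hN : ∀ s ∈ S, ∀ u ∈ A \ S, G.Adj s u → u ∈ N) (hr : S.ncard ≤ r) (hW : S.ncard ≤ W) :
    IsLayering G A S r W (Sᶜ.indicator fun v => d v + 1) where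
  adj u hu v hv huv := by
    by_cases huS : u ∈ S
    · simp [huS]
    by_cases hvS : v ∈ S
    · simp [huS, hvS, h.root u (hN v hvS u ⟨hu, huS⟩ huv.symm)]
    · simpa [huS, hvS] using h.adj u ⟨hu, huS⟩ v ⟨hv, hvS⟩ huv
  root u hu := by simp [hu]
  root_card := (Set.ncard_le_ncard fun u hu => by simpa using hu.2).trans hr
  bag_card v hv := by
    by_cases hvS : v ∈ S
    · refine (Set.ncard_le_ncard fun u hu => ?_).trans hW
      simpa [hvS] using hu.2.1
    refine (Set.ncard_le_ncard ?_).trans (h.bag_card v ⟨hv, hvS⟩)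
    have hpos : ∀ z, (Sᶜ.indicator (fun v => d v + 1)) v ≤ (Sᶜ.indicator fun v => d v + 1) z →
        z ∉ S ∧ d v ≤ d z := fun z hz => by
      by_cases hzS : z ∈ S
      · simp [hvS, hzS] at hz
      · exact ⟨hzS, by simpa [hvS, hzS] using hz⟩
    rintro u ⟨huA, hu, hreach⟩
    have huS := (hpos u hu.ge).1
    exact ⟨⟨huA, huS⟩, by simpa [huS, hvS] using hu,
      hreach.mono (within_mono le_rfl fun z hz => ⟨⟨hz.1, (hpos z hz.2).1⟩, (hpos z hz.2).2⟩)⟩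

theorem ncard_part (X : Set V) (comp : V → ι) (A : Set V) (c : ι) :
    (part X comp A c).ncard = (A ∩ X).ncard + (A \ X ∩ comp ⁻¹' {c}).ncard := by
  rw [← Set.ncard_union_eq (Set.disjoint_left.2 fun u hu hu' => hu'.1.2 hu.2)]
  congr 1
  ext u
  by_cases huX : u ∈ X <;> simp +contextual [part, huX]

theorem ncard_part_union_inter (h : S ⊆ A) (X : Set V) (comp : V → ι) (c : ι) :
    (part X comp (S ∪ A ∩ X) c).ncard = (A ∩ X).ncard + (S \ X ∩ comp ⁻¹' {c}).ncard := by
  rw [ncard_part, Set.union_inter_distrib_right, Set.inter_assoc, Set.inter_self,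
    Set.union_eq_self_of_subset_left (Set.inter_subset_inter_left X h), Set.union_sdiff_distrib,
    Set.sdiff_eq_empty.2 Set.inter_subset_right, Set.union_empty]

theorem ncard_eq_sum_ncard_inter_preimage [Fintype ι] (comp : V → ι) (A : Set V) :
    A.ncard = ∑ c, (A ∩ comp ⁻¹' {c}).ncard := by
  classical
  have := Fintype.ofFinite V
  rw [Set.ncard_eq_toFinset_card', Finset.card_eq_sum_card_fiberwise (f := comp)
    (t := Finset.univ) fun _ _ => Finset.mem_coe.2 (Finset.mem_univ _)]
  refine Finset.sum_congr rfl fun c _ => ?_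
  rw [Set.ncard_eq_toFinset_card']
  congr 1
  ext
  simp

theorem IsLayering.glue {rc : ι → ℕ} {d : ι → V → ℕ}
    (hcomp : ∀ u ∉ X, ∀ v ∉ X, G.Adj u v → comp u = comp v) (hXS : A ∩ X ⊆ S)
    (h : ∀ c, IsLayering G (part X comp A c) (part X comp S c) (rc c) W (d c))
    (hr : {u | u ∈ A ∧ Xᶜ.indicator (fun v => d (comp v) v) u = 0}.ncard ≤ r) (hrW : r ≤ W) :
    IsLayering G A S r W (Xᶜ.indicator fun v => d (comp v) v) where
  adj u hu v hv huv := by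
    by_cases huX : u ∈ X
    · simp [huX]
    by_cases hvX : v ∈ X
    · have hv0 : d (comp u) v = 0 := (h _).root v ⟨hXS ⟨hv, hvX⟩, .inl hvX⟩
      simpa [huX, hvX, hv0] using (h (comp u)).adj u ⟨hu, .inr rfl⟩ v ⟨hv, .inl hvX⟩ huv
    · have hc := hcomp u huX v hvX huv
      simpa [huX, hvX, hc] using (h (comp v)).adj u ⟨hu, .inr hc⟩ v ⟨hv, .inr rfl⟩ huv
  root u hu := by
    by_cases huX : u ∈ X
    · simp [huX]
    · simpa [huX] using (h (comp u)).root u ⟨hu, .inr rfl⟩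
  root_card := hr
  bag_card v hv := by
    by_cases hv0 : Xᶜ.indicator (fun v => d (comp v) v) v = 0
    · refine (Set.ncard_le_ncard fun u hu => ?_).trans (hr.trans hrW)
      exact ⟨hu.1, hu.2.1.trans hv0⟩
    have hvX : v ∉ X := fun hvX => hv0 (by simp [hvX])
    have hpos : ∀ z, Xᶜ.indicator (fun v => d (comp v) v) v ≤
        Xᶜ.indicator (fun v => d (comp v) v) z → z ∉ X ∧ d (comp v) v ≤ d (comp z) z := by
      intro z hz
      have hzX : z ∉ X := fun hzX => hv0 (by simpa [hzX] using hz)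
      exact ⟨hzX, by simpa [hvX, hzX] using hz⟩
    refine (Set.ncard_le_ncard ?_).trans ((h (comp v)).bag_card v ⟨hv, .inr rfl⟩)
    rintro u ⟨huA, hu, hreach⟩
    obtain ⟨⟨-, huX, huc, -⟩, hreach'⟩ := mem_and_reachable_within_of_closed
      (B' := {z | z ∈ A ∧ z ∉ X ∧ comp z = comp v ∧ d (comp v) v ≤ d (comp v) z}) hreach
      ⟨hv, hvX, rfl, le_rfl⟩ fun a ha b hb hab => by
        obtain ⟨hbX, hle⟩ := hpos b hb.2
        have hbc : comp b = comp v := (hcomp a ha.2.1 b hbX hab).symm.trans ha.2.2.1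
        exact ⟨hb.1, hbX, hbc, hbc ▸ hle⟩
    exact ⟨⟨huA, .inr huc⟩, by simpa [huX, hvX, huc] using hu,
      hreach'.mono (within_mono le_rfl fun z hz => ⟨⟨hz.1, .inr hz.2.2.1⟩, hz.2.2.2⟩)⟩

theorem IsLayering.ncard_inter_add_ncard_root_le {d : ι → V → ℕ} {c : ι}
    (h : IsLayering G (part X comp A c) (part X comp S c) r W (d c)) (hXS : A ∩ X ⊆ S) :
    (A ∩ X).ncard + ({u | u ∈ A ∧ Xᶜ.indicator (fun v => d (comp v) v) u = 0} \ X ∩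
      comp ⁻¹' {c}).ncard ≤ r := by
  rw [← ncard_part_union_inter fun u hu => hu.1]
  refine (Set.ncard_le_ncard fun u hu => ?_).trans h.root_card
  have huA : u ∈ A := hu.1.elim (fun hu => hu.1) fun hu => hu.1
  refine ⟨⟨huA, hu.2⟩, ?_⟩
  by_cases huX : u ∈ X
  · exact h.root u ⟨hXS ⟨huA, huX⟩, hu.2⟩
  · have huc : comp u = c := hu.2.resolve_left huX
    have hu0 := (hu.1.resolve_right fun hu => huX hu.2).2
    simpa [huX, huc] using hu0

/-- If at least two of the `a i` reach `2 * n`, all terms gain together `4 * n` over `2 * a i`; if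
only one does, the balance condition bounds it; if none does, the sum is at most `m`. -/
theorem sum_max_add_le {ι : Type*} {s : Finset ι} {a : ι → ℕ} {n m : ℕ}
    (hbal : ∀ i ∈ s, 2 * a i ≤ m) (hm : 4 * n < m) (hsum : ∑ i ∈ s, a i ≤ m) :
    ∑ i ∈ s, max (a i) (2 * a i - 2 * n) + 4 * n ≤ 2 * m := by
  classical
  have hsmall : ∀ t : Finset ι, (∀ i ∈ t, a i < 2 * n) →
      ∑ i ∈ t, max (a i) (2 * a i - 2 * n) ≤ ∑ i ∈ t, a i := fun t ht =>
    Finset.sum_le_sum fun i hi => by have := ht i hi; omega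
  have hdouble : ∀ t : Finset ι, ∑ i ∈ t, max (a i) (2 * a i - 2 * n) ≤ 2 * ∑ i ∈ t, a i :=
    fun t => Finset.mul_sum t a 2 ▸ Finset.sum_le_sum fun i _ => by omega
  by_cases hone : ∃ i ∈ s, 2 * n ≤ a i
  · obtain ⟨i, hi, hai⟩ := hone
    have hbali := hbal i hi
    rw [← Finset.add_sum_erase s _ hi] at hsum ⊢
    by_cases htwo : ∃ j ∈ s.erase i, 2 * n ≤ a j
    · obtain ⟨j, hj, haj⟩ := htwo
      rw [← Finset.add_sum_erase _ _ hj] at hsum ⊢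
      have hrest := hdouble ((s.erase i).erase j)
      omega
    · push Not at htwo
      have hrest := hsmall _ htwo
      omega
  · push Not at hone
    have hrest := hsmall s hone
    omega

theorem ncard_le_of_balanced [Finite ι] {R : Set V} {n : ℕ} (hX : X.ncard ≤ n)
    (hbig : 4 * n < S.ncard) (hbal : ∀ c, 2 * (S \ X ∩ comp ⁻¹' {c}).ncard ≤ S.ncard)
    (hR : ∀ c, (R \ X ∩ comp ⁻¹' {c}).ncard ≤
      max (S \ X ∩ comp ⁻¹' {c}).ncard (2 * (S \ X ∩ comp ⁻¹' {c}).ncard - 2 * n)) :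
    R.ncard ≤ 2 * S.ncard - 3 * n := by
  have := Fintype.ofFinite ι
  have hsum : ∑ c, (S \ X ∩ comp ⁻¹' {c}).ncard ≤ S.ncard := by
    rw [← ncard_eq_sum_ncard_inter_preimage]
    exact Set.ncard_le_ncard Set.sdiff_subset
  have hout : (R \ X).ncard + 4 * n ≤ 2 * S.ncard := by
    rw [ncard_eq_sum_ncard_inter_preimage comp]
    exact (Nat.add_le_add_right (Finset.sum_le_sum fun c _ => hR c) _).trans
      (sum_max_add_le (fun c _ => hbal c) hbig hsum)
  have hin : (R ∩ X).ncard ≤ n := (Set.ncard_le_ncard Set.inter_subset_right).trans hX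
  have hsplit := Set.ncard_inter_add_ncard_sdiff_eq_ncard R X
  omega

/-- For every `S ⊆ A` with at most `s` vertices, `G[A]` has a layering with `S` in its lowest layer
and with the bounds on the lowest layer and on the bags that carry the induction on `A`. -/
def Layerable (G : SimpleGraph V) (n s : ℕ) (A : Set V) : Prop :=
  ∀ S ⊆ A, S.ncard ≤ s →
    ∃ d, IsLayering G A S (max S.ncard (2 * S.ncard - 3 * n)) (2 * s - 3 * n) d

theorem Layerable.exists_isLayering_of_ncard_le {n s Δ : ℕ} (h : Layerable G n s (A \ S))
    (hΔ : ∀ v, (G.neighborSet v).ncard ≤ Δ) (hns : 4 * n ≤ s) (hs : 4 * n * Δ ≤ s)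
    (hS : S.ncard ≤ 4 * n) :
    ∃ d, IsLayering G A S (max S.ncard (2 * S.ncard - 3 * n)) (2 * s - 3 * n) d := by
  have hN : (A \ S ∩ ⋃ v ∈ S, G.neighborSet v).ncard ≤ s :=
    calc (A \ S ∩ ⋃ v ∈ S, G.neighborSet v).ncard ≤ (⋃ v ∈ S, G.neighborSet v).ncard :=
          Set.ncard_le_ncard Set.inter_subset_right
      _ ≤ S.ncard * Δ := ncard_biUnion_neighborSet_le hΔ S
      _ ≤ 4 * n * Δ := Nat.mul_le_mul_right Δ hS
      _ ≤ s := hs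
  obtain ⟨d, hd⟩ := h _ Set.inter_subset_left hN
  exact ⟨_, hd.cons (fun v hv u hu huv => ⟨hu, Set.mem_biUnion hv huv⟩) (le_max_left _ _)
    (by omega)⟩

theorem two_mul_ncard_sdiff_inter_component_le (S : Set V)
    (hX : ∀ v ∉ X, 2 * (S ∩ component G X v).ncard ≤ S.ncard) (c : Set V) :
    2 * (S \ X ∩ component G X ⁻¹' {c}).ncard ≤ S.ncard := by
  rcases (S \ X ∩ component G X ⁻¹' {c}).eq_empty_or_nonempty with hempty | ⟨v, hv, hvc⟩
  · simp [hempty]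
  refine (Nat.mul_le_mul_left 2 (Set.ncard_le_ncard fun u hu => ?_)).trans (hX v hv.2)
  exact ⟨hu.1.1, hvc ▸ hu.2 ▸ mem_component_self G X u⟩

theorem part_ssubset {n : ℕ} (hSA : S ⊆ A) (hXn : X.ncard ≤ n) (hS : 4 * n < S.ncard)
    (hbal : ∀ c, 2 * (S \ X ∩ comp ⁻¹' {c}).ncard ≤ S.ncard) (c : ι) : part X comp A c ⊂ A := by
  refine ⟨fun u hu => hu.1, fun hA => ?_⟩
  have hle : S.ncard ≤ (part X comp S c).ncard :=
    Set.ncard_le_ncard fun u hu => ⟨hu, (hA (hSA hu)).2⟩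
  have hin : (S ∩ X).ncard ≤ n := (Set.ncard_le_ncard Set.inter_subset_right).trans hXn
  have hc := hbal c
  rw [ncard_part] at hle
  omega

theorem Layerable.exists_isLayering_of_lt_ncard {n s : ℕ} (h : ∀ A' ⊂ A, Layerable G n s A')
    (hsep : HasSeparators G n) (hSA : S ⊆ A) (hSs : S.ncard ≤ s) (hS : 4 * n < S.ncard) :
    ∃ d, IsLayering G A S (max S.ncard (2 * S.ncard - 3 * n)) (2 * s - 3 * n) d := by
  obtain ⟨X, hXn, hX⟩ := hsep S
  have hbal := two_mul_ncard_sdiff_inter_component_le S hX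
  have hAX : (A ∩ X).ncard ≤ n := (Set.ncard_le_ncard Set.inter_subset_right).trans hXn
  have hXS : A ∩ X ⊆ S ∪ A ∩ X := Set.subset_union_right
  have hpart := ncard_part_union_inter hSA X (component G X)
  choose d hd using fun c => h _ (part_ssubset hSA hXn hS hbal c) _
    (part_mono (Set.union_subset hSA Set.inter_subset_left) c)
    (by have hc := hbal c; rw [hpart]; omega)
  have hroot : {u | u ∈ A ∧ Xᶜ.indicator (fun v => d (component G X v) v) u = 0}.ncard ≤
      2 * S.ncard - 3 * n := by
    refine ncard_le_of_balanced hXn hS hbal fun c => ?_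
    have hc := (hd c).ncard_inter_add_ncard_root_le hXS
    rw [hpart] at hc
    omega
  have hcomp : ∀ u ∉ X, ∀ v ∉ X, G.Adj u v → component G X u = component G X v :=
    fun u hu v hv huv =>
      (component_eq_of_mem (mem_component_of_adj hu (mem_component_self G X u) hv huv)).symm
  have hglue := IsLayering.glue hcomp hXS hd (hroot.trans (le_max_right S.ncard _)) (by omega)
  exact ⟨_, { hglue with root := fun u hu => hglue.root u (.inl hu) }⟩

theorem layerable {n Δ : ℕ} (hn : 1 ≤ n) (hΔ₁ : 1 ≤ Δ) (hΔ : ∀ v, (G.neighborSet v).ncard ≤ Δ)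
    (hsep : HasSeparators G n) (A : Set V) : Layerable G n (4 * n * Δ) A := by
  have hns : 4 * n ≤ 4 * n * Δ := Nat.le_mul_of_pos_right _ hΔ₁
  induction A using WellFoundedLT.induction with
  | ind A ih =>
  intro S hSA hS
  rcases Nat.lt_or_ge (4 * n) S.ncard with hbig | hsmall
  · exact Layerable.exists_isLayering_of_lt_ncard ih hsep hSA hS hbig
  rcases S.eq_empty_or_nonempty with rfl | ⟨v, hv⟩
  · rcases A.eq_empty_or_nonempty with rfl | ⟨v, hv⟩
    · exact ⟨fun _ => 0, ⟨by simp, by simp, by simp, by simp⟩⟩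
    · have hlt : A \ {v} ⊂ A := Set.sdiff_ssubset_left_iff.2 ⟨v, hv, rfl⟩
      obtain ⟨d, hd⟩ := (ih _ hlt).exists_isLayering_of_ncard_le hΔ hns le_rfl
        (by rw [Set.ncard_singleton]; omega)
      exact ⟨_, hd.shift _⟩
  · have hlt : A \ S ⊂ A := Set.sdiff_ssubset_left_iff.2 ⟨v, hSA hv, hv⟩
    exact (ih _ hlt).exists_isLayering_of_ncard_le hΔ hns le_rfl hsmall

end Layerings

section Bounds

variable {V C : Type*} {G : SimpleGraph V}

theorem exists_strollNonrepetitive [Finite V] {n Δ : ℕ} (hn : 1 ≤ n) (hΔ₁ : 1 ≤ Δ)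
    (hΔ : ∀ v, (G.neighborSet v).ncard ≤ Δ) (hsep : HasSeparators G n) :
    ∃ f : V → Option Ordering × Fin (2 * (4 * n * Δ) - 3 * n), StrollNonrepetitive G f := by
  obtain ⟨ℓ, hℓ⟩ := exists_squarePalindromeFree
  obtain ⟨d, hd⟩ := layerable hn hΔ₁ hΔ hsep Set.univ ∅ (Set.empty_subset _) (by simp)
  obtain ⟨g, hg⟩ := exists_injective_on_bags fun v => hd.bag_card v trivial
  exact ⟨_, strollNonrepetitive_of_layering hℓ (fun u v => hd.adj u trivial v trivial) hg⟩

theorem hasSeparators_treewidth_add_one [Finite V] (G : SimpleGraph V) :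
    HasSeparators G (treewidth G + 1) := by
  obtain ⟨H, hGH, hH, hfree⟩ := treewidth_spec G
  exact (hH.hasSeparators hfree).mono hGH

theorem one_le_treewidth_of_adj [Finite V] {a b : V} (h : G.Adj a b) : 1 ≤ treewidth G := by
  classical
  obtain ⟨H, hGH, -, hfree⟩ := treewidth_spec G
  by_contra! h0
  rw [Nat.lt_one_iff.1 h0] at hfree
  refine hfree {a, b} ⟨?_, Finset.card_pair h.ne⟩
  simpa [SimpleGraph.isClique_insert] using fun _ => hGH h

theorem one_le_treewidth [Fintype V] [DecidableRel G.Adj] (hΔ : 1 ≤ G.maxDegree) :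
    1 ≤ treewidth G := by
  have : Nonempty V := by
    by_contra hV
    rw [not_nonempty_iff] at hV
    simp at hΔ
  obtain ⟨v, hv⟩ := G.exists_maximal_degree_vertex
  obtain ⟨u, hu⟩ := (G.degree_pos_iff_exists_adj v).1 (hv ▸ hΔ)
  exact one_le_treewidth_of_adj hu

theorem pathNumber_le [Finite C] {f : V → C} (hf : PathNonrepetitive G f) :
    pathNumber G ≤ Nat.card C :=
  Nat.sInf_le ⟨Finite.equivFin C ∘ f, fun t w ht hw hrep =>
    hf t w ht hw fun i hi => (Finite.equivFin C).injective (hrep i hi)⟩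

theorem walkNumber_le [Finite C] {f : V → C} (hf : WalkNonrepetitive G f) :
    walkNumber G ≤ Nat.card C :=
  Nat.sInf_le ⟨Finite.equivFin C ∘ f, fun t w hw hrep =>
    hf t w hw fun i hi => (Finite.equivFin C).injective (hrep i hi)⟩

theorem pathNumber_le_and_walkNumber_le [Finite V] {Δ : ℕ} (hΔ₁ : 1 ≤ Δ)
    (hΔ : ∀ v, (G.neighborSet v).ncard ≤ Δ) :
    pathNumber G ≤ 4 * (2 * (4 * (treewidth G + 1) * Δ) - 3 * (treewidth G + 1)) ∧
    walkNumber G ≤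
      4 * (2 * (4 * (treewidth G + 1) * Δ) - 3 * (treewidth G + 1)) * (Δ ^ 2 + 1) := by
  obtain ⟨f, hf⟩ := exists_strollNonrepetitive (Nat.le_add_left 1 _) hΔ₁ hΔ
    (hasSeparators_treewidth_add_one G)
  obtain ⟨g, hg⟩ := exists_injOn_neighborSet hΔ
  have hcolours : Nat.card (Option Ordering) = 4 := by
    rw [Nat.card_eq_fintype_card]
    rfl
  simpa only [Nat.card_prod, hcolours, Nat.card_fin] using
    And.intro (pathNumber_le hf.pathNonrepetitive) (walkNumber_le (hf.walkNonrepetitive hg))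

theorem ncard_neighborSet_le_maxDegree [Fintype V] [DecidableRel G.Adj] (v : V) :
    (G.neighborSet v).ncard ≤ G.maxDegree := by
  rw [Set.ncard_eq_toFinset_card', Set.toFinset_card, SimpleGraph.card_neighborSet_eq_degree]
  exact G.degree_le_maxDegree v

theorem cast_colour_count_le {k Δ : ℕ} (hΔ : 1 ≤ Δ) :
    ((4 * (2 * (4 * (k + 1) * Δ) - 3 * (k + 1)) : ℕ) : ℝ) ≤
      10 * ((k : ℝ) + 1) * (7 / 2 * (Δ : ℝ) - 1) := by
  have hle : k + 1 ≤ (k + 1) * Δ := Nat.le_mul_of_pos_right _ hΔ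
  have hnat : 4 * (2 * (4 * (k + 1) * Δ) - 3 * (k + 1)) + 10 * (k + 1) ≤ 35 * ((k + 1) * Δ) := by
    rw [mul_assoc 4]
    omega
  have hreal := (Nat.cast_le (α := ℝ)).2 hnat
  push_cast at hreal ⊢
  linarith

theorem cast_pathNumber_le_and_cast_walkNumber_le [Fintype V] [DecidableRel G.Adj]
    (hΔ : 1 ≤ G.maxDegree) :
    (pathNumber G : ℝ) ≤ 10 * ((treewidth G : ℝ) + 1) * (7 / 2 * (G.maxDegree : ℝ) - 1) ∧
    (walkNumber G : ℝ) ≤ 10 * ((treewidth G : ℝ) + 1) * (7 / 2 * (G.maxDegree : ℝ) - 1) *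
      ((G.maxDegree : ℝ) ^ 2 + 1) := by
  obtain ⟨hpath, hwalk⟩ := pathNumber_le_and_walkNumber_le hΔ ncard_neighborSet_le_maxDegree
  have hcount := cast_colour_count_le (k := treewidth G) hΔ
  refine ⟨(Nat.cast_le.2 hpath).trans hcount, (Nat.cast_le.2 hwalk).trans ?_⟩
  rw [Nat.cast_mul, Nat.cast_add, Nat.cast_pow, Nat.cast_one]
  gcongr

end Bounds

end NonRep

theorem mainTheorem3 :
    (∀ (V : Type*) [Fintype V] (G : SimpleGraph V) [DecidableRel G.Adj] (k Δ : ℕ),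
      NonRep.treewidth G = k → G.maxDegree = Δ → 1 ≤ Δ →
        (NonRep.pathNumber G : ℝ) ≤ 10 * ((k : ℝ) + 1) * (7 / 2 * (Δ : ℝ) - 1) ∧
        (NonRep.walkNumber G : ℝ) ≤
          10 * ((k : ℝ) + 1) * (7 / 2 * (Δ : ℝ) - 1) * ((Δ : ℝ) ^ 2 + 1)) ∧
    (∃ c : ℝ, ∀ (V : Type*) [Fintype V] (G : SimpleGraph V) [DecidableRel G.Adj] (k Δ : ℕ),
      NonRep.treewidth G = k → G.maxDegree = Δ → 1 ≤ Δ →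
        (NonRep.pathNumber G : ℝ) ≤ c * k * Δ ∧
        (NonRep.walkNumber G : ℝ) ≤ c * k * (Δ : ℝ) ^ 3) := by
  refine ⟨?_, 140, ?_⟩
  · rintro V _ G _ k Δ rfl rfl hΔ
    exact NonRep.cast_pathNumber_le_and_cast_walkNumber_le hΔ
  · rintro V _ G _ k Δ rfl rfl hΔ
    obtain ⟨hpath, hwalk⟩ := NonRep.cast_pathNumber_le_and_cast_walkNumber_le hΔ
    have hk : (1 : ℝ) ≤ NonRep.treewidth G := Nat.one_le_cast.2 (NonRep.one_le_treewidth hΔ)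
    have hD : (1 : ℝ) ≤ G.maxDegree := Nat.one_le_cast.2 hΔ
    generalize (NonRep.treewidth G : ℝ) = k at *
    generalize (G.maxDegree : ℝ) = D at *
    have hkD : 0 ≤ k * D := by positivity
    have hfactor : 10 * (k + 1) * (7 / 2 * D - 1) ≤ 70 * k * D := by
      nlinarith [mul_nonneg (sub_nonneg.2 hk) (zero_le_one.trans hD)]
    refine ⟨by linarith, ?_⟩
    calc (NonRep.walkNumber G : ℝ) ≤ 70 * k * D * (D ^ 2 + 1) := hwalk.trans (by gcongr)
      _ ≤ 70 * k * D * (D ^ 2 + D ^ 2) := by gcongr; exact one_le_pow₀ hD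
      _ = 140 * k * D ^ 3 := by ring
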